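/- **Setting.** Let $n,t$ be natural numbers with $3t<n$. There are $n$ nodes $p_1,\dots,p_n$ and a set $\mathit{Correct}$ of at least $n-t$ of them; the other nodes are Byzantine. Each ordered pair of nodes has its own channel, holding a finite collection of packets in transit; only $p_i$ puts packets into the channel from $p_i$. Executions are infinite, asynchronous (interleaving) sequences of atomic events and start from an arbitrary system state (arbitrary local states and arbitrary finite channel contents). The events are: an iteration of a correct node's do-forever loop, which ends by sending a message to every node (each sent message is placed in the channel an arbitrary finite number of times, possibly zero); the receipt by a correct node of any packet in transit to it; an invocation of $\mathsf{propose}(v)$, $\mathsf{result}()$ or $\mathsf{recycle}()$ by a correct node; the sending of an arbitrary message by a Byzantine node. Nodes may use common random coins. Let $A$ be an asynchronous message-passing consensus algorithm in this model with finitely many possible messages, a function $\mathsf{result}()$ that reads the local state and returns a decided value, an error symbol, or $\bot$, and a meta-status used/unused of its local state: it is unused in the initial state, $\mathsf{propose}$ makes it used, and it then stays used until $\mathsf{recycle}()$. **Algorithm 1** ($A$ with delivery indications). Node $p_i$ also holds an array $delivered_i[1..n]$ with entries in $\{\mathsf{True},\mathsf{False},\bot\}$, initially all $\mathsf{False}$.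 Whenever $\mathsf{result}()$ returns a value other than $\bot$, it also sets $delivered_i[i]\gets\mathsf{True}$. Each loop iteration begins with: if $\mathsf{result}()=\bot$ then $delivered_i[i]\gets\bot$; it then runs the loop of $A$, and every message sent also carries $delivered_i[i]$. When a message carrying $d$ arrives from $p_j$, $p_i$ sets $delivered_i[j]\gets d$ and then handles the message as $A$ does. $\mathsf{wasDelivered}_i()$ returns $1$ if at least $n-t$ entries of $delivered_i$ are $\mathsf{True}$, and $0$ otherwise. $\mathsf{recycle}()$ resets the local state and $delivered_i$ to their initial values and empties the attached channels. An execution is *admissible* if every correct node runs its loop infinitely often; any message that a correct node sends infinitely often to a correct node is received by it infinitely often; every correct node invokes $\mathsf{result}()$ infinitely often; every correct node's object is used at some time (its $\mathsf{propose}$ was invoked); and no correct node invokes $\mathsf{recycle}()$. *BC-completion* (of $A$ or of Algorithm 1) on a set of executions means: in each admissible execution of the set there is a time from which on $\mathsf{result}()\neq\bot$ at all correct nodes. *BC-validity* means: in each execution of the set in which no correct node invokes $\mathsf{recycle}()$ and which starts with all correct nodes in their initial states and all channels empty, if all correct nodes propose and propose only $v$, then no correct node decides a value other than $v$. *BC-agreement*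 means: in each such execution (whatever is proposed), no two different values are decided by correct nodes. **Theorem.** Let $\mathcal E$ be any set of executions of $A$ (all of them, or, e.g., those of a probability-one event), and let $\mathcal E'$ be the set of executions of Algorithm 1 that become members of $\mathcal E$ when the delivery indications are dropped from local states and messages. 1. If $A$ satisfies BC-completion on $\mathcal E$, then Algorithm 1 is a recyclable consensus object on $\mathcal E'$, that is, in every admissible execution in $\mathcal E'$: (a) if at some time some correct node has $\mathsf{wasDelivered}()=1$, then there is a later time from which on all correct nodes have $\mathsf{wasDelivered}()=1$; (b) if every correct node has an invocation of $\mathsf{result}()$ that returns a value other than $\bot$, then from some time on all correct nodes have $\mathsf{wasDelivered}()=1$. Moreover, Algorithm 1 satisfies BC-completion on $\mathcal E'$. 2. If $A$ satisfies BC-validity on $\mathcal E$, so does Algorithm 1 on $\mathcal E'$; and the same holds for BC-agreement. -/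

import Mathlib

namespace RecyclableConsensus

/-- What `result()` returns: a decided value, the error symbol, or `⊥` (nothing yet). -/
inductive Outcome (V : Type*) where
  | value (v : V)
  | error
  | pending

/-- The atomic events of an execution. `M` is the type of message payloads. -/
inductive Event (n : ℕ) (V M : Type*) where
  /-- Correct node `i` runs one iteration of its do-forever loop, which ends by sending one message
  to every node; the network puts `copies j` copies of the message for `j` in transit
  (`0` is an omission, `2` or more a duplication). -/
  | loop (i : Fin n) (copies : Fin n → ℕ)
  /-- Correct node `j` receives from the channel `i → j` a packet in transit (in any order). -/
  | receive (i j : Fin n) (m : M)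
  /-- Correct node `i` invokes `propose(v)`. -/
  | propose (i : Fin n) (v : V)
  /-- Correct node `i` invokes `result()`. -/
  | result (i : Fin n)
  /-- Correct node `i` invokes `recycle()`. -/
  | recycle (i : Fin n)
  /-- Faulty node `i` sends an arbitrary message to `j`. -/
  | byzantine (i j : Fin n) (m : M)

/-- A system state: all local states, and for each ordered pair `(i, j)` the finite multiset of
packets in transit from `i` to `j`. -/
structure Config (n : ℕ) (S M : Type*) where
  loc : Fin n → S
  chan : Fin n → Fin n → Multiset M

/-- The data of an infinite execution: the common coin of every round, the sequence of system
states, and the event that takes each system state to the next one. -/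
structure Run (n : ℕ) (V S M : Type*) where
  coin : ℕ → Bool
  cfg : ℕ → Config n S M
  ev : ℕ → Event n V M

/-- The code of a (randomized, message-passing) consensus object for nodes `0, …, n-1`, the first
argument being the identifier of the node that runs it. -/
structure Object (n : ℕ) (V S M : Type*) where
  /-- the initial local state, to which `recycle()` also resets -/
  init : Fin n → S
  /-- one iteration of the do-forever loop: it may use the common coins, and yields the new local
  state and the message for each node -/
  loop : Fin n → (ℕ → Bool) → S → S × (Fin n → M)
  /-- `receive j i m s`: the handler at `j` of the message `m` that arrives from `i` -/
  receive : Fin n → Fin n → M → S → S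
  propose : Fin n → V → S → S
  /-- the outcome that `result()` returns -/
  result : Fin n → S → Outcome V
  /-- the local state after an invocation of `result()` -/
  afterResult : Fin n → S → S
  /-- the meta-status of the object at the node is "used" -/
  used : Fin n → S → Prop

namespace Object

variable {n : ℕ} {V S M : Type*}

/-- `c.chan` with the channel `i → j` replaced by `Q`. -/
def setChan (ch : Fin n → Fin n → Multiset M) (i j : Fin n) (Q : Multiset M) :
    Fin n → Fin n → Multiset M :=
  fun a b => if a = i ∧ b = j then Q else ch a b

/-- `O.Step C β e c c'`: with correct nodes `C` and common coins `β`, event `e` takes system state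
`c` to `c'`. -/
def Step (O : Object n V S M) (C : Finset (Fin n)) (β : ℕ → Bool) :
    Event n V M → Config n S M → Config n S M → Prop
  | .loop i copies, c, c' =>
      i ∈ C ∧
      c' = ⟨Function.update c.loc i (O.loop i β (c.loc i)).1,
        fun a b => if a = i
          then c.chan a b + Multiset.replicate (copies b) ((O.loop i β (c.loc i)).2 b)
          else c.chan a b⟩
  | .receive i j m, c, c' =>
      j ∈ C ∧ ∃ Q, c.chan i j = m ::ₘ Q ∧
      c' = ⟨Function.update c.loc j (O.receive j i m (c.loc j)), setChan c.chan i j Q⟩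
  | .propose i v, c, c' =>
      i ∈ C ∧ c' = ⟨Function.update c.loc i (O.propose i v (c.loc i)), c.chan⟩
  | .result i, c, c' =>
      i ∈ C ∧ c' = ⟨Function.update c.loc i (O.afterResult i (c.loc i)), c.chan⟩
  | .recycle i, c, c' =>
      -- `recycle()` also initializes all channels attached to the node
      i ∈ C ∧ c' = ⟨Function.update c.loc i (O.init i),
        fun a b => if a = i ∨ b = i then 0 else c.chan a b⟩
  | .byzantine i j m, c, c' =>
      i ∉ C ∧ c' = ⟨c.loc, setChan c.chan i j (m ::ₘ c.chan i j)⟩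

/-- `R` is an execution of `O`, from an arbitrary system state. -/
def IsExecution (O : Object n V S M) (C : Finset (Fin n)) (R : Run n V S M) : Prop :=
  ∀ k, O.Step C R.coin (R.ev k) (R.cfg k) (R.cfg (k + 1))

/-- At step `k`, node `i` sends message `m` to node `j`. -/
def Sends (O : Object n V S M) (R : Run n V S M) (k : ℕ) (i j : Fin n) (m : M) : Prop :=
  (∃ copies, R.ev k = .loop i copies) ∧ (O.loop i R.coin ((R.cfg k).loc i)).2 j = m

/-- Fair communication between correct nodes: a message that is sent infinitely often is received
infinitely often. -/
def FairCommunication (O : Object n V S M) (C : Finset (Fin n)) (R : Run n V S M) : Prop :=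
  ∀ i ∈ C, ∀ j ∈ C, ∀ m : M,
    (∀ k, ∃ k' ≥ k, O.Sends R k' i j m) → ∀ k, ∃ k' ≥ k, R.ev k' = .receive i j m

/-- No correct node invokes `recycle()`. -/
def NoRecycle (C : Finset (Fin n)) (R : Run n V S M) : Prop :=
  ∀ k, ∀ i ∈ C, R.ev k ≠ .recycle i

/-- The asynchronous executions in which the object is supposed to complete. The system state at
the start is arbitrary. -/
structure Admissible (O : Object n V S M) (C : Finset (Fin n)) (R : Run n V S M) : Prop where
  exec : O.IsExecution C R
  /-- every correct node keeps running its loop -/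
  live : ∀ i ∈ C, ∀ k, ∃ k' ≥ k, ∃ copies, R.ev k' = .loop i copies
  fair : O.FairCommunication C R
  /-- every correct node invokes `result()` infinitely often -/
  resultCalled : ∀ i ∈ C, ∀ k, ∃ k' ≥ k, R.ev k' = .result i
  /-- every correct node has its invocation of `propose()`, before or during the execution -/
  proposed : ∀ i ∈ C, ∃ k, O.used i ((R.cfg k).loc i)
  noRecycle : NoRecycle C R

/-- The system state that follows the recycling of the object. -/
def Initial (O : Object n V S M) (C : Finset (Fin n)) (c : Config n S M) : Prop :=
  (∀ i ∈ C, c.loc i = O.init i) ∧ ∀ i j, c.chan i j = 0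

/-- BC-completion in the executions in `E`, from whatever system state they start: eventually
`result()` is, and stays, different from `⊥` at all correct nodes. -/
def BCCompletion (O : Object n V S M) (C : Finset (Fin n)) (E : Set (Run n V S M)) : Prop :=
  ∀ R ∈ E, O.Admissible C R →
    ∃ K, ∀ k ≥ K, ∀ i ∈ C, O.result i ((R.cfg k).loc i) ≠ .pending

/-- BC-validity in the properly initialized executions in `E`. -/
def BCValidity (O : Object n V S M) (C : Finset (Fin n)) (E : Set (Run n V S M)) : Prop :=
  ∀ R ∈ E, O.IsExecution C R → O.Initial C (R.cfg 0) → NoRecycle C R →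
    ∀ v : V, (∀ i ∈ C, (∃ k, R.ev k = .propose i v) ∧ ∀ k w, R.ev k = .propose i w → w = v) →
      ∀ i ∈ C, ∀ k w, O.result i ((R.cfg k).loc i) = .value w → w = v

/-- BC-agreement in the properly initialized executions in `E`. -/
def BCAgreement (O : Object n V S M) (C : Finset (Fin n)) (E : Set (Run n V S M)) : Prop :=
  ∀ R ∈ E, O.IsExecution C R → O.Initial C (R.cfg 0) → NoRecycle C R →
    ∀ i ∈ C, ∀ j ∈ C, ∀ k l v w, O.result i ((R.cfg k).loc i) = .value v →
      O.result j ((R.cfg l).loc j) = .value w → v = w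

/-- Recyclability in the executions in `E`, for an object with interface function `wasDelivered`:
* once all correct nodes have been delivered a result, `wasDelivered()` returns `1` at all of them
  from some time on;
* if at some time some correct node has `wasDelivered() = 1`, then from some later time on all
  correct nodes have `wasDelivered() = 1`. -/
structure Recyclable (O : Object n V S M) (wasDelivered : S → ℕ) (C : Finset (Fin n))
    (E : Set (Run n V S M)) : Prop where
  delivery : ∀ R ∈ E, O.Admissible C R →
    (∀ i ∈ C, ∃ k, R.ev k = .result i ∧ O.result i ((R.cfg k).loc i) ≠ .pending) →
      ∃ K, ∀ k ≥ K, ∀ j ∈ C, wasDelivered ((R.cfg k).loc j) = 1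
  agreement : ∀ R ∈ E, O.Admissible C R →
    ∀ k, (∃ i ∈ C, wasDelivered ((R.cfg k).loc i) = 1) →
      ∃ K ≥ k, ∀ k' ≥ K, ∀ j ∈ C, wasDelivered ((R.cfg k').loc j) = 1

end Object

/-- The code of a consensus algorithm before delivery indications are added; `result()` only reads
the local state. -/
structure Algorithm (n : ℕ) (V S M : Type*) where
  init : Fin n → S
  loop : Fin n → (ℕ → Bool) → S → S × (Fin n → M)
  receive : Fin n → Fin n → M → S → S
  propose : Fin n → V → S → S
  result : Fin n → S → Outcome V
  used : Fin n → S → Prop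
  not_used_init : ∀ i, ¬ used i (init i)
  used_propose : ∀ i v s, used i (propose i v s)
  used_loop : ∀ i β s, used i s → used i (loop i β s).1
  used_receive : ∀ i j m s, used i s → used i (receive i j m s)

namespace Algorithm

variable {n : ℕ} {V S M : Type*}

/-- The algorithm itself as a consensus object. -/
def toObject (A : Algorithm n V S M) : Object n V S M where
  init := A.init
  loop := A.loop
  receive := A.receive
  propose := A.propose
  result := A.result
  afterResult := fun _ s => s
  used := A.used

/-- The array `delivered` of node `i` after an invocation of `result()`. The entries `some true`,
`some false`, `none` stand for `True`, `False`, `⊥`. -/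
def markDelivered (i : Fin n) (o : Outcome V) (d : Fin n → Option Bool) : Fin n → Option Bool :=
  match o with
  | .pending => d
  | _ => Function.update d i (some true)

/-- The consistency test: invoke `result()`, and if it returns `⊥`, set `delivered[i]` to `⊥`. -/
def consistencyTest (i : Fin n) (o : Outcome V) (d : Fin n → Option Bool) :
    Fin n → Option Bool :=
  match o with
  | .pending => Function.update d i none
  | _ => markDelivered i o d

/-- The recyclable variation on `A`: the local state also holds the array `delivered`, and each
message also carries the entry `delivered[i]` of its sender `i`. -/
def recyclable (A : Algorithm n V S M) :
    Object n V (S × (Fin n → Option Bool)) (M × Option Bool) where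
  init := fun i => (A.init i, fun _ => some false)
  loop := fun i β s =>
    let d := consistencyTest i (A.result i s.1) s.2
    let r := A.loop i β s.1
    ((r.1, d), fun j => (r.2 j, d i))
  receive := fun i j m s => (A.receive i j m.1 s.1, Function.update s.2 j m.2)
  propose := fun i v s => (A.propose i v s.1, s.2)
  result := fun i s => A.result i s.1
  afterResult := fun i s => (s.1, markDelivered i (A.result i s.1) s.2)
  used := fun i s => A.used i s.1

end Algorithm

/-- The interface function `wasDelivered()`: `1` if at least `n - t` entries of `delivered` are
`True`, and `0` otherwise. -/
def wasDelivered {n : ℕ} {S : Type*} (t : ℕ) (s : S × (Fin n → Option Bool)) : ℕ :=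
  if ∃ P : Finset (Fin n), n - t ≤ P.card ∧ ∀ k ∈ P, s.2 k = some true then 1 else 0

/-- An event with the delivery indications dropped from the messages. -/
def Event.forget {n : ℕ} {V M : Type*} : Event n V (M × Option Bool) → Event n V M
  | .loop i copies => .loop i copies
  | .receive i j m => .receive i j m.1
  | .propose i v => .propose i v
  | .result i => .result i
  | .recycle i => .recycle i
  | .byzantine i j m => .byzantine i j m.1

/-- A run with the delivery indications dropped from the local states and the messages; coins and
scheduling are kept. -/
def Run.forget {n : ℕ} {V S M : Type*}
    (R : Run n V (S × (Fin n → Option Bool)) (M × Option Bool)) : Run n V S M where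
  coin := R.coin
  cfg := fun k => ⟨fun i => ((R.cfg k).loc i).1, fun i j => ((R.cfg k).chan i j).map Prod.fst⟩
  ev := fun k => (R.ev k).forget

end RecyclableConsensus

/-!
Dropping the delivery indications turns an execution of `A.recyclable` into an execution of `A`
with the same outcomes of `result()`. The one point that needs an argument is fair communication: a
payload `m` that is sent infinitely often is sent infinitely often with one and the same indication
`d`, because there are only three indications, so that `(m, d)`, and hence `m`, is received
infinitely often (`Algorithm.admissible_forget`). This gives BC-completion, BC-validity and
BC-agreement.

For recyclability, BC-completion provides a time from which on `result()` is not `⊥` at correct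
nodes. From then on the loop of a correct node sends the indication `True` only, so the number of
other packets in a channel between correct nodes no longer grows, and each receipt of such a packet
decreases it: eventually no such packet is received any more
(`Algorithm.eventually_not_receive_stale`). As there are finitely many messages, some message with
indication `True` is received after that, and the corresponding entry of `delivered` is `True` for
good (`Algorithm.eventually_delivered`). The correct nodes form a set of at least `n - t` such
entries, so `wasDelivered()` is eventually `1` at all correct nodes of every admissible execution,
which yields both clauses of recyclability.
-/

namespace RecyclableConsensus

open Filter

/-! ### Dropping the delivery indications -/

/-- A system state with the delivery indications dropped from the local states and the packets. -/
def Config.forget {n : ℕ} {S M : Type*}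
    (c : Config n (S × (Fin n → Option Bool)) (M × Option Bool)) : Config n S M :=
  ⟨fun i => (c.loc i).1, fun i j => (c.chan i j).map Prod.fst⟩

namespace Algorithm

variable {n : ℕ} {V S M : Type*} {A : Algorithm n V S M} {C : Finset (Fin n)}

lemma fst_update {S D : Type*} (f : Fin n → S × D) (i : Fin n) (s : S × D) :
    (fun a => (Function.update f i s a).1) = Function.update (fun a => (f a).1) i s.1 := by
  funext a
  by_cases h : a = i
  · subst h; simp
  · simp [h]

lemma map_setChan (ch : Fin n → Fin n → Multiset (M × Option Bool)) (i j : Fin n)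
    (Q : Multiset (M × Option Bool)) :
    (fun a b => (Object.setChan ch i j Q a b).map Prod.fst) =
      Object.setChan (fun a b => (ch a b).map Prod.fst) i j (Q.map Prod.fst) := by
  funext a b
  unfold Object.setChan
  split_ifs <;> rfl

lemma step_forget {β : ℕ → Bool} {e : Event n V (M × Option Bool)}
    {c c' : Config n (S × (Fin n → Option Bool)) (M × Option Bool)}
    (h : A.recyclable.Step C β e c c') :
    A.toObject.Step C β e.forget c.forget c'.forget := by
  cases e with
  | loop i copies =>
    obtain ⟨hi, rfl⟩ := h
    refine ⟨hi, ?_⟩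
    simp only [Config.forget, fst_update, Config.mk.injEq]
    refine ⟨rfl, ?_⟩
    funext a b
    split_ifs
    · simp [recyclable, toObject]
    · rfl
  | receive i j m =>
    obtain ⟨hj, Q, hQ, rfl⟩ := h
    refine ⟨hj, Q.map Prod.fst, by simp [Config.forget, hQ], ?_⟩
    simp only [Config.forget, fst_update, map_setChan]
    rfl
  | propose i v =>
    obtain ⟨hi, rfl⟩ := h
    refine ⟨hi, ?_⟩
    simp only [Config.forget, fst_update]
    rfl
  | result i =>
    obtain ⟨hi, rfl⟩ := h
    refine ⟨hi, ?_⟩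
    simp only [Config.forget, fst_update]
    rfl
  | recycle i =>
    obtain ⟨hi, rfl⟩ := h
    refine ⟨hi, ?_⟩
    simp only [Config.forget, fst_update, Config.mk.injEq]
    refine ⟨rfl, ?_⟩
    funext a b
    split_ifs <;> rfl
  | byzantine i j m =>
    obtain ⟨hi, rfl⟩ := h
    refine ⟨hi, ?_⟩
    simp only [Config.forget, map_setChan, Multiset.map_cons]

variable {R : Run n V (S × (Fin n → Option Bool)) (M × Option Bool)}

lemma isExecution_forget (h : A.recyclable.IsExecution C R) :
    A.toObject.IsExecution C R.forget :=
  fun k => step_forget (h k)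

lemma initial_forget (h : A.recyclable.Initial C (R.cfg 0)) :
    A.toObject.Initial C (R.forget.cfg 0) :=
  ⟨fun i hi => congrArg Prod.fst (h.1 i hi), fun i j => by simp [Run.forget, h.2 i j]⟩

lemma forget_eq_loop {e : Event n V (M × Option Bool)} {i : Fin n} {copies : Fin n → ℕ} :
    e.forget = .loop i copies ↔ e = .loop i copies := by
  cases e <;> simp [Event.forget]

lemma forget_eq_propose {e : Event n V (M × Option Bool)} {i : Fin n} {v : V} :
    e.forget = .propose i v ↔ e = .propose i v := by
  cases e <;> simp [Event.forget]

lemma forget_eq_recycle {e : Event n V (M × Option Bool)} {i : Fin n} :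
    e.forget = .recycle i ↔ e = .recycle i := by
  cases e <;> simp [Event.forget]

lemma noRecycle_forget (h : Object.NoRecycle C R) : Object.NoRecycle C R.forget :=
  fun k i hi he => h k i hi (forget_eq_recycle.1 he)

/-- Pigeonhole principle for events that recur along a sequence of times. -/
lemma exists_frequently_of_finite {ι : Type*} [Finite ι] {p : ι → ℕ → Prop}
    (h : ∃ᶠ k in atTop, ∃ x, p x k) : ∃ x, ∃ᶠ k in atTop, p x k := by
  by_contra hx
  push Not at hx
  exact h ((eventually_all.2 hx).mono fun k hk ⟨x, hxk⟩ => hk x hxk)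

lemma fairCommunication_forget (h : A.recyclable.FairCommunication C R) :
    A.toObject.FairCommunication C R.forget := by
  intro i hi j hj m hm
  replace hm := frequently_atTop.2 hm
  refine frequently_atTop.1 ?_
  obtain ⟨d, hd⟩ : ∃ d : Option Bool, ∃ᶠ k in atTop, A.recyclable.Sends R k i j (m, d) := by
    refine exists_frequently_of_finite (hm.mono ?_)
    rintro k ⟨⟨copies, hc⟩, hs⟩
    exact ⟨_, ⟨copies, forget_eq_loop.1 hc⟩, Prod.ext hs rfl⟩
  have hr := frequently_atTop.2 (h i hi j hj (m, d) (frequently_atTop.1 hd))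
  refine hr.mono fun k hk => ?_
  simp [Run.forget, hk, Event.forget]

lemma admissible_forget (h : A.recyclable.Admissible C R) :
    A.toObject.Admissible C R.forget where
  exec := isExecution_forget h.exec
  live := fun i hi k => by
    obtain ⟨k', hk, copies, hc⟩ := h.live i hi k
    exact ⟨k', hk, copies, forget_eq_loop.2 hc⟩
  fair := fairCommunication_forget h.fair
  resultCalled := fun i hi k => by
    obtain ⟨k', hk, hr⟩ := h.resultCalled i hi k
    exact ⟨k', hk, by simp [Run.forget, hr, Event.forget]⟩
  proposed := h.proposed
  noRecycle := noRecycle_forget h.noRecycle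

lemma recyclable_bcCompletion {E : Set (Run n V S M)} (h : A.toObject.BCCompletion C E) :
    A.recyclable.BCCompletion C (Run.forget ⁻¹' E) :=
  fun R hR hadm => h R.forget hR (admissible_forget hadm)

lemma recyclable_bcValidity {E : Set (Run n V S M)} (h : A.toObject.BCValidity C E) :
    A.recyclable.BCValidity C (Run.forget ⁻¹' E) := by
  intro R hR hex hinit hrec v hv
  refine h R.forget hR (isExecution_forget hex) (initial_forget hinit) (noRecycle_forget hrec) v ?_
  intro i hi
  obtain ⟨⟨k, hk⟩, huniq⟩ := hv i hi
  exact ⟨⟨k, forget_eq_propose.2 hk⟩, fun k w hw => huniq k w (forget_eq_propose.1 hw)⟩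

lemma recyclable_bcAgreement {E : Set (Run n V S M)} (h : A.toObject.BCAgreement C E) :
    A.recyclable.BCAgreement C (Run.forget ⁻¹' E) :=
  fun R hR hex hinit hrec =>
    h R.forget hR (isExecution_forget hex) (initial_forget hinit) (noRecycle_forget hrec)

/-! ### Propagation of the delivery indications -/

lemma markDelivered_self {i : Fin n} {o : Outcome V} (d : Fin n → Option Bool)
    (ho : o ≠ .pending) : markDelivered i o d i = some true := by
  cases o <;> simp_all [markDelivered]

lemma markDelivered_of_ne {i j : Fin n} (o : Outcome V) (d : Fin n → Option Bool) (h : j ≠ i) :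
    markDelivered i o d j = d j := by
  cases o <;> simp [markDelivered, h]

lemma consistencyTest_self {i : Fin n} {o : Outcome V} (d : Fin n → Option Bool)
    (ho : o ≠ .pending) : consistencyTest i o d i = some true := by
  cases o <;> simp_all [consistencyTest, markDelivered]

lemma consistencyTest_of_ne {i j : Fin n} (o : Outcome V) (d : Fin n → Option Bool)
    (h : j ≠ i) : consistencyTest i o d j = d j := by
  cases o <;> simp [consistencyTest, markDelivered, h]

/-- The number of packets whose delivery indication is not `True`. -/
def staleCount (Q : Multiset (M × Option Bool)) : ℕ :=
  Q.countP fun p => p.2 ≠ some true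

lemma staleCount_step_le {β : ℕ → Bool} {e : Event n V (M × Option Bool)}
    {c c' : Config n (S × (Fin n → Option Bool)) (M × Option Bool)} {i : Fin n} (j : Fin n)
    (h : A.recyclable.Step C β e c c') (hi : i ∈ C) (hres : A.result i (c.loc i).1 ≠ .pending) :
    staleCount (c'.chan i j) ≤ staleCount (c.chan i j) := by
  cases e with
  | loop a copies =>
    obtain ⟨-, rfl⟩ := h
    by_cases hia : i = a
    · subst hia
      have hd := consistencyTest_self (i := i) (c.loc i).2 hres
      simp only [if_true, staleCount, Multiset.countP_add]
      simp [recyclable, hd, Multiset.countP_eq_zero, Multiset.mem_replicate]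
    · simp [hia]
  | receive a b m =>
    obtain ⟨-, Q, hQ, rfl⟩ := h
    simp only [Object.setChan]
    split_ifs with hab
    · obtain ⟨rfl, rfl⟩ := hab
      rw [hQ]
      exact Multiset.countP_le_of_le _ (Multiset.le_cons_self Q m)
    · exact le_rfl
  | propose a v => obtain ⟨-, rfl⟩ := h; exact le_rfl
  | result a => obtain ⟨-, rfl⟩ := h; exact le_rfl
  | recycle a =>
    obtain ⟨-, rfl⟩ := h
    simp only
    split_ifs
    · simp [staleCount]
    · exact le_rfl
  | byzantine a b m =>
    obtain ⟨ha, rfl⟩ := h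
    have hia : i ≠ a := fun hia => ha (hia ▸ hi)
    simp [Object.setChan, hia]

lemma staleCount_receive_lt {β : ℕ → Bool} {i j : Fin n} {m : M × Option Bool}
    {c c' : Config n (S × (Fin n → Option Bool)) (M × Option Bool)}
    (h : A.recyclable.Step C β (.receive i j m) c c') (hm : m.2 ≠ some true) :
    staleCount (c'.chan i j) < staleCount (c.chan i j) := by
  obtain ⟨-, Q, hQ, rfl⟩ := h
  simp only [Object.setChan, and_self, if_true, hQ, staleCount]
  rw [Multiset.countP_cons_of_pos (p := fun p : M × Option Bool => p.2 ≠ some true) Q hm]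
  exact Nat.lt_succ_self _

/-- A packet whose indication is not `True` is received from a node with settled outcome only
finitely often: the number of such packets in the channel attains its minimum. -/
lemma eventually_not_receive_stale {i : Fin n} (j : Fin n) (hex : A.recyclable.IsExecution C R)
    (hi : i ∈ C) (hres : ∀ᶠ k in atTop, A.result i ((R.cfg k).loc i).1 ≠ .pending) :
    ∀ᶠ k in atTop, ∀ m : M × Option Bool, R.ev k = .receive i j m → m.2 = some true := by
  obtain ⟨K, hK⟩ := eventually_atTop.1 hres
  have hanti : Antitone fun l => staleCount ((R.cfg (K + l)).chan i j) :=
    antitone_nat_of_succ_le fun l => staleCount_step_le j (hex (K + l)) hi (hK _ (by omega))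
  obtain ⟨N, hN⟩ : ∃ N, ∀ l, staleCount ((R.cfg (K + N)).chan i j) ≤
      staleCount ((R.cfg (K + l)).chan i j) :=
    ⟨_, fun l => Function.argmin_le (fun l => staleCount ((R.cfg (K + l)).chan i j)) l⟩
  refine eventually_atTop.2 ⟨K + N, fun k hk m hm => ?_⟩
  by_contra hstale
  obtain ⟨l, rfl⟩ := Nat.exists_eq_add_of_le ((Nat.le_add_right K N).trans hk)
  have hstep := hex (K + l)
  rw [hm] at hstep
  have hlt := staleCount_receive_lt hstep hstale
  have hle : staleCount ((R.cfg (K + l)).chan i j) ≤ staleCount ((R.cfg (K + N)).chan i j) :=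
    hanti (Nat.le_of_add_le_add_left hk)
  exact (hlt.trans_le hle).not_ge (hN (l + 1))

/-- Once `result()` is not `⊥` at a node, an entry `True` of its array `delivered` persists, unless
it is overwritten on receipt of a packet with another indication. For the node's own entry, the
consistency test and `result()` write `True`, and the receipts are those from the channel of the
node to itself. -/
lemma delivered_step {β : ℕ → Bool} {e : Event n V (M × Option Bool)}
    {c c' : Config n (S × (Fin n → Option Bool)) (M × Option Bool)} {i j : Fin n}
    (h : A.recyclable.Step C β e c c') (hres : A.result j (c.loc j).1 ≠ .pending)
    (hrec : e ≠ .recycle j) (hm : ∀ m : M × Option Bool, e = .receive i j m → m.2 = some true)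
    (hd : (c.loc j).2 i = some true) : (c'.loc j).2 i = some true := by
  cases e with
  | loop a copies =>
    obtain ⟨-, rfl⟩ := h
    by_cases hja : j = a
    · subst hja
      by_cases hij : i = j
      · subst hij
        simpa [recyclable] using consistencyTest_self (c.loc i).2 hres
      · simpa [recyclable, consistencyTest_of_ne _ _ hij] using hd
    · simpa [hja] using hd
  | receive a b m =>
    obtain ⟨-, Q, -, rfl⟩ := h
    by_cases hjb : j = b
    · subst hjb
      by_cases hia : i = a
      · subst hia
        simpa [recyclable] using hm m rfl
      · simpa [recyclable, hia] using hd
    · simpa [hjb] using hd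
  | propose a v =>
    obtain ⟨-, rfl⟩ := h
    by_cases hja : j = a
    · subst hja; simpa [recyclable] using hd
    · simpa [hja] using hd
  | result a =>
    obtain ⟨-, rfl⟩ := h
    by_cases hja : j = a
    · subst hja
      by_cases hij : i = j
      · subst hij
        simpa [recyclable] using markDelivered_self (c.loc i).2 hres
      · simpa [recyclable, markDelivered_of_ne _ _ hij] using hd
    · simpa [hja] using hd
  | recycle a =>
    obtain ⟨-, rfl⟩ := h
    have hja : j ≠ a := fun hja => hrec (hja ▸ rfl)
    simpa [hja] using hd
  | byzantine a b m => obtain ⟨-, rfl⟩ := h; exact hd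

lemma delivered_receive {β : ℕ → Bool} {i j : Fin n} {m : M × Option Bool}
    {c c' : Config n (S × (Fin n → Option Bool)) (M × Option Bool)}
    (h : A.recyclable.Step C β (.receive i j m) c c') : (c'.loc j).2 i = m.2 := by
  obtain ⟨-, Q, -, rfl⟩ := h
  simp [recyclable]

lemma frequently_receive [Finite M] (hadm : A.recyclable.Admissible C R) {i j : Fin n}
    (hi : i ∈ C) (hj : j ∈ C) : ∃ᶠ k in atTop, ∃ m, R.ev k = .receive i j m := by
  have hs : ∃ᶠ k in atTop, ∃ m, A.recyclable.Sends R k i j m :=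
    (frequently_atTop.2 (hadm.live i hi)).mono fun k hk => ⟨_, hk, rfl⟩
  obtain ⟨m, hm⟩ := exists_frequently_of_finite hs
  exact (frequently_atTop.2 (hadm.fair i hi j hj m (frequently_atTop.1 hm))).mono
    fun k hk => ⟨m, hk⟩

lemma eventually_delivered [Finite M] (hadm : A.recyclable.Admissible C R)
    (hres : ∀ᶠ k in atTop, ∀ i ∈ C, A.result i ((R.cfg k).loc i).1 ≠ .pending)
    {i j : Fin n} (hi : i ∈ C) (hj : j ∈ C) :
    ∀ᶠ k in atTop, ((R.cfg k).loc j).2 i = some true := by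
  have hstale := eventually_not_receive_stale j hadm.exec hi (hres.mono fun k hk => hk i hi)
  obtain ⟨K, hK⟩ := eventually_atTop.1 (hres.and hstale)
  obtain ⟨k₀, hk₀, m, hm⟩ := frequently_atTop.1 (frequently_receive hadm hi hj) K
  refine eventually_atTop.2 ⟨k₀ + 1, fun k hk => ?_⟩
  induction k, hk using Nat.le_induction with
  | base =>
    have hstep := hadm.exec k₀
    rw [hm] at hstep
    rw [delivered_receive hstep, (hK k₀ hk₀).2 m hm]
  | succ k hk ih =>
    have hKk := hK k (by omega)
    exact delivered_step (hadm.exec k) (hKk.1 j hj) (hadm.noRecycle k j hj) hKk.2 ih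

/-! ### Recyclability -/

lemma wasDelivered_eq_one {t : ℕ} {s : S × (Fin n → Option Bool)} (hC : n - t ≤ C.card)
    (h : ∀ i ∈ C, s.2 i = some true) : wasDelivered t s = 1 :=
  if_pos ⟨C, hC, h⟩

lemma eventually_wasDelivered [Finite M] {t : ℕ} (hC : n - t ≤ C.card)
    (hadm : A.recyclable.Admissible C R)
    (hres : ∀ᶠ k in atTop, ∀ i ∈ C, A.result i ((R.cfg k).loc i).1 ≠ .pending) :
    ∀ᶠ k in atTop, ∀ j ∈ C, wasDelivered t ((R.cfg k).loc j) = 1 := by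
  have h : ∀ᶠ k in atTop, ∀ j ∈ C, ∀ i ∈ C, ((R.cfg k).loc j).2 i = some true :=
    (eventually_all_finset C).2 fun j hj => (eventually_all_finset C).2 fun i hi =>
      eventually_delivered hadm hres hi hj
  exact h.mono fun k hk j hj => wasDelivered_eq_one hC (hk j hj)

lemma recyclable_recyclable [Finite M] {t : ℕ} (hC : n - t ≤ C.card) {E : Set (Run n V S M)}
    (h : A.toObject.BCCompletion C E) :
    A.recyclable.Recyclable (wasDelivered t) C (Run.forget ⁻¹' E) := by
  have key : ∀ R ∈ Run.forget ⁻¹' E, A.recyclable.Admissible C R →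
      ∀ᶠ k in atTop, ∀ j ∈ C, wasDelivered t ((R.cfg k).loc j) = 1 := fun R hR hadm =>
    eventually_wasDelivered hC hadm (eventually_atTop.2 (recyclable_bcCompletion h R hR hadm))
  refine ⟨fun R hR hadm _ => eventually_atTop.1 (key R hR hadm), fun R hR hadm k _ => ?_⟩
  obtain ⟨K, hK⟩ := eventually_atTop.1 (key R hR hadm)
  exact ⟨max K k, le_max_right _ _, fun k' hk' => hK k' ((le_max_left _ _).trans hk')⟩

end Algorithm

end RecyclableConsensus

open RecyclableConsensus in
theorem theorem1 {n t : ℕ} (ht : 3 * t < n) {V S M : Type*} [Finite M]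
    (A : Algorithm n V S M) (C : Finset (Fin n)) (hC : n - t ≤ C.card)
    (E : Set (Run n V S M)) :
    (A.toObject.BCCompletion C E →
      A.recyclable.Recyclable (wasDelivered t) C (Run.forget ⁻¹' E) ∧
      A.recyclable.BCCompletion C (Run.forget ⁻¹' E)) ∧
    (A.toObject.BCValidity C E → A.recyclable.BCValidity C (Run.forget ⁻¹' E)) ∧
    (A.toObject.BCAgreement C E → A.recyclable.BCAgreement C (Run.forget ⁻¹' E)) := by
  exact ⟨fun h => ⟨Algorithm.recyclable_recyclable hC h, Algorithm.recyclable_bcCompletion h⟩,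
    Algorithm.recyclable_bcValidity, Algorithm.recyclable_bcAgreement⟩
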